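/- For integers $n\ge 1$ and $r\ge 1$ let $[n]=\{1,\dots,n\}$; an $r$-coloring of $[n]$ is a map $c\colon [n]\to\{1,\dots,r\}$. It is called rainbow 3-AP-free if there are no integers $a,d\ge 1$ with $a+2d\le n$ such that $c(a)$, $c(a+d)$, $c(a+2d)$ are pairwise distinct. Let $g_r([n])$ denote the number of rainbow 3-AP-free $r$-colorings of $[n]$. Let $r\ge 3$ be a fixed integer. Then, as $n\to\infty$, $$g_r([n])=\left(\binom{r}{2}+o(1)\right)2^n .$$ Moreover, almost all rainbow 3-AP-free $r$-colorings of $[n]$ are 2-colorings: as $n\to\infty$, the proportion of those that use at most two of the $r$ colors, among all rainbow 3-AP-free $r$-colorings of $[n]$, tends to $1$. -/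

import Mathlib

open Filter Topology

/-- The discrete interval `[n] = {1, …, n}`. -/
def intInterval (n : ℕ) : Finset ℕ := Finset.Icc 1 n

/-- `x, y, z` is a 3-term arithmetic progression `a, a + d, a + 2d` with positive
common difference `d`. -/
def IsThreeAP (x y z : ℕ) : Prop :=
  ∃ d : ℕ, 0 < d ∧ y = x + d ∧ z = x + 2 * d

/-- An `r`-coloring `c` of the set `A` is rainbow 3-AP-free: no 3-term arithmetic progression
of elements of `A` receives three pairwise distinct colors. -/
def RainbowThreeAPFree {r : ℕ} {A : Finset ℕ} (c : A → Fin r) : Prop :=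
  ∀ x y z : A, IsThreeAP x y z → ¬ (c x ≠ c y ∧ c x ≠ c z ∧ c y ≠ c z)

/-- `g_r(A)`: the number of rainbow 3-AP-free `r`-colorings of `A`. -/
noncomputable def numRainbowFree (r : ℕ) (A : Finset ℕ) : ℕ :=
  Set.ncard {c : A → Fin r | RainbowThreeAPFree c}

/-- The number of rainbow 3-AP-free `r`-colorings of `A` that use at most two of the
`r` colors. -/
noncomputable def numRainbowFreeTwoColored (r : ℕ) (A : Finset ℕ) : ℕ :=
  Set.ncard {c : A → Fin r | RainbowThreeAPFree c ∧ (Set.range c).ncard ≤ 2}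

/-! Colorings with at most two colors are automatically rainbow-free, and there are `r.choose 2 * 2
^ n` of them up to a bounded error. The content is that colorings with three or more colors number
`o(2 ^ n)`.

An a priori bound `C * (l + 1) * 2 ^ l` (`exists_rainbowFreeCount_le`) comes from coloring positions
in order: a new position has two choices unless the earlier coloring is invariant under doubling the
distance to it, which is very restrictive. By affine invariance the bound applies to every
progression, so a family whose colorings are determined on a few progressions of total length `n -
L` has size at most polynomial times `2 ^ (n - L)`.

With `L = n / 28`, `threeColored_subset` covers the three-colored case by polynomially many such
families and one generic family. In the latter, three colors on the even positions of an initial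
segment force, by pigeonhole and periodicity, one of any four consecutive later even positions, so a
block of eight positions has at most `2 ^ 7` extensions. Over `L` blocks this again saves `2 ^ L`,
which beats all polynomial factors. -/

/-- The number of restrictions to `A` of colorings in `S`. -/
noncomputable def traceCard {α : Type*} (S : Set (ℕ → α)) (A : Finset ℕ) : ℕ :=
  ((fun (c : ℕ → α) (x : A) => c x) '' S).ncard

/-- A coloring of `{0, …, n - 1}` without rainbow 3-term arithmetic progression. -/
def RainbowFreeBelow {α : Type*} (n : ℕ) (c : ℕ → α) : Prop :=
  ∀ x y z : ℕ, x < n → y < n → z < n → x + z = 2 * y → c x = c y ∨ c x = c z ∨ c y = c z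

/-- The number of rainbow 3-AP-free colorings of `{0, …, n - 1}`. -/
noncomputable def rainbowFreeCount (α : Type*) (n : ℕ) : ℕ :=
  traceCard {c : ℕ → α | RainbowFreeBelow n c} (Finset.range n)

/-- The arithmetic progression `a, a + q, …, a + (l - 1) q`. -/
def progression (a q l : ℕ) : Finset ℕ := (Finset.range l).image fun i => a + q * i

lemma mem_progression {a q l x : ℕ} : x ∈ progression a q l ↔ ∃ i < l, a + q * i = x := by
  simp [progression]

/-! ### Counting traces of families of colorings -/

section TraceCard

variable {α : Type*}

lemma RainbowFreeBelow.mono {m n : ℕ} {c : ℕ → α} (h : RainbowFreeBelow n c) (hmn : m ≤ n) :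
    RainbowFreeBelow m c :=
  fun x y z hx hy hz => h x y z (by omega) (by omega) (by omega)

/-- Choosing one coloring per trace makes `f` injective on traces, so any data determining the
colors on `A` bounds their number. -/
lemma traceCard_image_le_of_determined [Finite α] {β : Type*} {S : Set (ℕ → α)} {A : Finset ℕ}
    {T : Set β} (hT : T.Finite) (f : (ℕ → α) → β) (hf : ∀ c ∈ S, f c ∈ T)
    (h : ∀ c ∈ S, ∀ c' ∈ S, f c = f c' → ∀ x ∈ A, c x = c' x) : traceCard S A ≤ T.ncard := by
  classical
  have key : ∀ p : ((fun (c : ℕ → α) (x : A) => c x) '' S), ∃ c ∈ S, (fun x : A => c x) = p.1 :=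
    fun p => p.2
  choose g hg hgp using key
  rw [traceCard, ← Nat.card_coe_set_eq, ← Nat.card_coe_set_eq]
  have := hT.to_subtype
  refine Nat.card_le_card_of_injective (fun p => (⟨f (g p), hf _ (hg p)⟩ : T)) ?_
  intro p q hpq
  have h1 := h _ (hg p) _ (hg q) (by simpa using hpq)
  apply Subtype.ext
  rw [← hgp p, ← hgp q]
  funext x
  exact h1 x x.2

lemma traceCard_le_of_determined [Finite α] {S T : Set (ℕ → α)} {A B : Finset ℕ} (hST : S ⊆ T)
    (h : ∀ c ∈ S, ∀ c' ∈ S, (∀ x ∈ B, c x = c' x) → ∀ x ∈ A, c x = c' x) :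
    traceCard S A ≤ traceCard T B := by
  refine traceCard_image_le_of_determined (Set.toFinite _) (fun c (x : B) => c x)
    (fun c hc => ⟨c, hST hc, rfl⟩) fun c hc c' hc' e => h c hc c' hc' fun x hx => ?_
  exact congrFun e ⟨x, hx⟩

lemma traceCard_mono [Finite α] {S T : Set (ℕ → α)} {A B : Finset ℕ} (hST : S ⊆ T)
    (hAB : A ⊆ B) : traceCard S A ≤ traceCard T B :=
  traceCard_le_of_determined hST fun _ _ _ _ h x hx => h x (hAB hx)

lemma traceCard_union_le (S T : Set (ℕ → α)) (A : Finset ℕ) :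
    traceCard (S ∪ T) A ≤ traceCard S A + traceCard T A := by
  rw [traceCard, Set.image_union]
  exact Set.ncard_union_le _ _

lemma traceCard_biUnion_le [Finite α] {ι : Type*} (I : Finset ι) (S : ι → Set (ℕ → α))
    (A : Finset ℕ) (k : ℕ) (h : ∀ i ∈ I, traceCard (S i) A ≤ k) :
    traceCard (⋃ i ∈ I, S i) A ≤ I.card * k := by
  classical
  induction I using Finset.induction_on with
  | empty => simp [traceCard]
  | insert a s ha ih =>
    rw [Finset.set_biUnion_insert, Finset.card_insert_of_notMem ha]
    have h1 := traceCard_union_le (S a) (⋃ i ∈ s, S i) A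
    have h2 := h a (by simp)
    have h3 := ih fun i hi => h i (by simp [hi])
    nlinarith

/-- If every coloring in `S` has at most `k` extensions from `A` to `B`, then passing from `A`
to `A ∪ B` multiplies the number of traces by at most `k`. -/
lemma traceCard_union_le_mul [Finite α] (S : Set (ℕ → α)) (A B : Finset ℕ) (k : ℕ)
    (h : ∀ c ∈ S, traceCard {c' ∈ S | ∀ x ∈ A, c' x = c x} B ≤ k) :
    traceCard S (A ∪ B) ≤ traceCard S A * k := by
  classical
  rcases S.eq_empty_or_nonempty with rfl | ⟨c₀, -⟩
  · simp [traceCard]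
  have : Nonempty (ℕ → α) := ⟨c₀⟩
  set U : Set (A → α) := (fun (c : ℕ → α) (x : A) => c x) '' S with hU
  have hUf : U.Finite := Set.toFinite _
  have key : ∀ p ∈ U, ∃ c ∈ S, (fun x : A => c x) = p := fun p hp => hp
  choose! g hg hgp using key
  have hcov : S ⊆ ⋃ p ∈ hUf.toFinset, {c' ∈ S | ∀ x ∈ A, c' x = g p x} := by
    intro c hc
    have hp : (fun x : A => c x) ∈ U := ⟨c, hc, rfl⟩
    simp only [Set.mem_iUnion]
    refine ⟨_, by simpa using hp, hc, fun x hx => ?_⟩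
    exact (congrFun (hgp _ hp) ⟨x, hx⟩).symm
  refine (traceCard_mono hcov subset_rfl).trans ?_
  have := traceCard_biUnion_le hUf.toFinset (fun p => {c' ∈ S | ∀ x ∈ A, c' x = g p x}) (A ∪ B) k ?_
  · rwa [← Set.ncard_eq_toFinset_card U hUf] at this
  intro p hp
  have hp' : p ∈ U := by simpa using hp
  refine le_trans (traceCard_le_of_determined subset_rfl ?_) (h _ (hg p hp'))
  intro c hc c' hc' e x hx
  rcases Finset.mem_union.1 hx with hx | hx
  · rw [hc.2 x hx, hc'.2 x hx]
  · exact e x hx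

lemma traceCard_union_le_mul_traceCard [Finite α] (S : Set (ℕ → α)) (A B : Finset ℕ) :
    traceCard S (A ∪ B) ≤ traceCard S A * traceCard S B :=
  traceCard_union_le_mul S A B _ fun _ _ => traceCard_mono (Set.sep_subset _ _) subset_rfl

lemma traceCard_singleton_le [Finite α] {S : Set (ℕ → α)} {w : ℕ} (V : Finset α)
    (h : ∀ c ∈ S, c w ∈ V) : traceCard S {w} ≤ V.card := by
  rw [← Set.ncard_coe_finset]
  refine traceCard_image_le_of_determined (Set.toFinite _) (fun c => c w) h ?_
  intro c _ c' _ e x hx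
  rw [Finset.mem_singleton.1 hx]
  exact e

lemma traceCard_range_succ_le [Finite α] (S : Set (ℕ → α)) (w k : ℕ)
    (h : ∀ c ∈ S, traceCard {c' ∈ S | ∀ x < w, c' x = c x} {w} ≤ k) :
    traceCard S (Finset.range (w + 1)) ≤ traceCard S (Finset.range w) * k := by
  have := traceCard_union_le_mul S (Finset.range w) {w} k (by simpa using h)
  rwa [Finset.union_comm, ← Finset.insert_eq, ← Finset.range_add_one] at this

lemma traceCard_le_one_of_eq [Finite α] {S : Set (ℕ → α)} {A : Finset ℕ}
    (h : ∀ c ∈ S, ∀ c' ∈ S, ∀ x ∈ A, c x = c' x) : traceCard S A ≤ 1 := by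
  have := traceCard_image_le_of_determined (S := S) (A := A) (Set.finite_singleton ())
    (fun _ => ()) (by simp) fun c hc c' hc' _ => h c hc c' hc'
  simpa using this

/-- Affine maps preserve 3-term progressions, so pulling back along `i ↦ a + q * i` gives a
rainbow-free coloring of an interval. -/
lemma traceCard_progression_le [Finite α] {S : Set (ℕ → α)} {n a q l : ℕ}
    (hS : ∀ c ∈ S, RainbowFreeBelow n c) (h : ∀ i < l, a + q * i < n) :
    traceCard S (progression a q l) ≤ rainbowFreeCount α l := by
  refine traceCard_image_le_of_determined (Set.toFinite _)
    (fun c (x : Finset.range l) => c (a + q * x)) ?_ ?_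
  · intro c hc
    refine ⟨fun i => c (a + q * i), ?_, rfl⟩
    intro x y z hx hy hz e
    refine hS c hc _ _ _ (h x hx) (h y hy) (h z hz) ?_
    have : q * (x + z) = q * (2 * y) := by rw [e]
    linarith
  · intro c _ c' _ e x hx
    obtain ⟨i, hi, rfl⟩ := mem_progression.1 hx
    exact congrFun e ⟨i, by simpa using hi⟩

lemma traceCard_range_le [Finite α] {S : Set (ℕ → α)} {n m : ℕ}
    (hS : ∀ c ∈ S, RainbowFreeBelow n c) (h : m ≤ n) :
    traceCard S (Finset.range m) ≤ rainbowFreeCount α m :=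
  traceCard_mono (fun c hc => (hS c hc).mono h) subset_rfl

/-- A position that ends a progression starting with two distinct colors has at most two
possible colors. -/
lemma traceCard_range_succ_le_two_mul [Finite α] {S : Set (ℕ → α)} {n w : ℕ} (hw : w < n)
    (hS : ∀ c ∈ S, RainbowFreeBelow n c)
    (h : ∀ c ∈ S, ∃ d, 2 * d ≤ w ∧ c (w - d) ≠ c (w - 2 * d)) :
    traceCard S (Finset.range (w + 1)) ≤ traceCard S (Finset.range w) * 2 := by
  classical
  refine traceCard_range_succ_le S w 2 fun c hc => ?_
  obtain ⟨d, hd, hne⟩ := h c hc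
  have hd0 : d ≠ 0 := by rintro rfl; simp at hne
  refine (traceCard_singleton_le {c (w - d), c (w - 2 * d)} ?_).trans Finset.card_le_two
  rintro c' ⟨hc', e⟩
  rw [← e (w - d) (by omega), ← e (w - 2 * d) (by omega)] at hne ⊢
  have := hS c' hc' (w - 2 * d) (w - d) w (by omega) (by omega) hw (by omega)
  simp only [Finset.mem_insert, Finset.mem_singleton]
  rcases this with h | h | h
  · exact absurd h.symm hne
  · exact Or.inr h.symm
  · exact Or.inl h.symm

/-! ### An a priori bound up to a linear factor -/

/-- If some `m - d`, `m - 2 * d` differ in color, position `m` has two choices. Otherwise the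
coloring below `m` is fixed by the odd distances to `m`, a progression of difference 2 and length
`(m + 1) / 2`. -/
lemma rainbowFreeCount_succ_le [Fintype α] (m : ℕ) :
    rainbowFreeCount α (m + 1) ≤
      2 * rainbowFreeCount α m + Fintype.card α * rainbowFreeCount α ((m + 1) / 2) := by
  classical
  set S : Set (ℕ → α) := {c | RainbowFreeBelow (m + 1) c ∧
    ∃ d, 2 * d ≤ m ∧ c (m - d) ≠ c (m - 2 * d)}
  set S' : Set (ℕ → α) := {c | RainbowFreeBelow (m + 1) c ∧
    ∀ d, 2 * d ≤ m → c (m - d) = c (m - 2 * d)}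
  have h1 : rainbowFreeCount α (m + 1) ≤ traceCard S (Finset.range (m + 1)) +
      traceCard S' (Finset.range (m + 1)) := by
    refine (traceCard_mono (fun c hc => ?_) subset_rfl).trans (traceCard_union_le _ _ _)
    by_cases h : ∃ d, 2 * d ≤ m ∧ c (m - d) ≠ c (m - 2 * d)
    · exact Or.inl ⟨hc, h⟩
    · push Not at h
      exact Or.inr ⟨hc, h⟩
  have h2 := traceCard_range_succ_le_two_mul (S := S) (Nat.lt_succ_self m) (fun c hc => hc.1)
    fun c hc => hc.2
  have h3 := traceCard_range_le (S := S) (m := m) (fun c hc => hc.1) (by omega)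
  have h4 := traceCard_range_succ_le S' m (Fintype.card α) fun c _ =>
    traceCard_singleton_le Finset.univ (by simp)
  have h5 : traceCard S' (Finset.range m) ≤
      traceCard S' (progression (m + 1 - 2 * ((m + 1) / 2)) 2 ((m + 1) / 2)) := by
    refine traceCard_le_of_determined subset_rfl fun c hc c' hc' e => ?_
    -- Factors of 2 are stripped from the distance until it is odd.
    have key : ∀ d, 1 ≤ d → d ≤ m → c (m - d) = c' (m - d) := by
      intro d
      induction d using Nat.strong_induction_on with
      | _ d ih =>
        intro hd hdm
        rcases Nat.even_or_odd' d with ⟨k, rfl | rfl⟩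
        · rw [← hc.2 k hdm, ← hc'.2 k hdm]
          exact ih k (by omega) (by omega) (by omega)
        · exact e _ (mem_progression.2 ⟨(m + 1) / 2 - 1 - k, by omega, by omega⟩)
    intro x hx
    have hx' : x < m := by simpa using hx
    have := key (m - x) (by omega) (by omega)
    rwa [Nat.sub_sub_self hx'.le] at this
  have h6 := traceCard_progression_le (S := S') (n := m + 1) (a := m + 1 - 2 * ((m + 1) / 2))
    (q := 2) (l := (m + 1) / 2) (fun c hc => hc.1) (fun i hi => by omega)
  have h7 := Nat.mul_le_mul_right (Fintype.card α) (h5.trans h6)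
  linarith

lemma exists_rainbowFreeCount_le (α : Type*) [Fintype α] :
    ∃ C : ℕ, 1 ≤ C ∧ ∀ l, rainbowFreeCount α l ≤ C * (l + 1) * 2 ^ l := by
  -- Beyond `m₀` the second term of the recursion is at most `C * 2 ^ (m + 1)`, exactly what raising
  -- the linear factor by one allows.
  obtain ⟨m₀, hm₀⟩ : ∃ m₀ : ℕ, ∀ m ≥ m₀, Fintype.card α * (m + 1) ≤ 2 ^ (m / 2) := by
    have ht : Tendsto (fun k : ℕ => ((Fintype.card α * (2 * k + 2) : ℕ) : ℝ) / 2 ^ k)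
        atTop (𝓝 0) := by
      have h1 := tendsto_pow_const_div_const_pow_of_one_lt 1 (one_lt_two (α := ℝ))
      have h0 := tendsto_pow_const_div_const_pow_of_one_lt 0 (one_lt_two (α := ℝ))
      have := (h1.const_mul (2 * Fintype.card α : ℝ)).add (h0.const_mul (2 * Fintype.card α : ℝ))
      simp only [mul_zero, add_zero] at this
      refine this.congr fun k => ?_
      push_cast
      ring
    obtain ⟨k₀, hk₀⟩ := eventually_atTop.1 (ht.eventually (gt_mem_nhds (zero_lt_one)))
    refine ⟨2 * k₀, fun m hm => ?_⟩
    have := hk₀ (m / 2) (by omega)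
    rw [div_lt_one (by positivity)] at this
    have h2 : Fintype.card α * (2 * (m / 2) + 2) < 2 ^ (m / 2) := by exact_mod_cast this
    refine le_trans (Nat.mul_le_mul_left _ ?_) h2.le
    omega
  refine ⟨1 + ∑ i ∈ Finset.range (m₀ + 1), rainbowFreeCount α i, by omega, fun l => ?_⟩
  set C := 1 + ∑ i ∈ Finset.range (m₀ + 1), rainbowFreeCount α i with hC
  induction l using Nat.strong_induction_on with
  | _ l ih =>
    by_cases hl : l ≤ m₀
    · have : rainbowFreeCount α l ≤ ∑ i ∈ Finset.range (m₀ + 1), rainbowFreeCount α i :=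
        Finset.single_le_sum (f := fun i => rainbowFreeCount α i) (fun _ _ => Nat.zero_le _)
          (by simp; omega)
      have h2 : C * 1 * 1 ≤ C * (l + 1) * 2 ^ l := by
        gcongr
        · omega
        · exact Nat.one_le_two_pow
      omega
    · obtain ⟨m, rfl⟩ : ∃ m, l = m + 1 := ⟨l - 1, by omega⟩
      have h1 := rainbowFreeCount_succ_le (α := α) m
      have h2 := ih m (by omega)
      have h3 := ih ((m + 1) / 2) (by omega)
      have h4 := hm₀ (m + 1) (by omega)
      have h5 : (m + 1) / 2 + 1 ≤ m + 1 + 1 := by omega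
      calc _ ≤ 2 * (C * (m + 1) * 2 ^ m) +
          Fintype.card α * (C * ((m + 1) / 2 + 1) * 2 ^ ((m + 1) / 2)) := by
            refine h1.trans ?_
            gcongr
        _ ≤ 2 * (C * (m + 1) * 2 ^ m) +
          Fintype.card α * (C * (m + 1 + 1) * 2 ^ ((m + 1) / 2)) := by gcongr
        _ = 2 * (C * (m + 1) * 2 ^ m) +
          C * (Fintype.card α * (m + 1 + 1)) * 2 ^ ((m + 1) / 2) := by ring
        _ ≤ 2 * (C * (m + 1) * 2 ^ m) + C * 2 ^ ((m + 1) / 2) * 2 ^ ((m + 1) / 2) := by gcongr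
        _ = 2 * (C * (m + 1) * 2 ^ m) + C * 2 ^ ((m + 1) / 2 + (m + 1) / 2) := by ring
        _ ≤ 2 * (C * (m + 1) * 2 ^ m) + C * 2 ^ (m + 1) := by
            have := Nat.pow_le_pow_right (n := 2) two_pos
              (show (m + 1) / 2 + (m + 1) / 2 ≤ m + 1 by omega)
            gcongr
        _ = _ := by ring

end TraceCard

/-! ### Structured and generic families -/

section Cases

variable {α : Type*}

lemma traceCard_biUnion_progression_le [Finite α] {ι : Type*} {S : Set (ℕ → α)} {n b : ℕ}
    (hS : ∀ c ∈ S, RainbowFreeBelow n c) (hb : ∀ l ≤ n, rainbowFreeCount α l ≤ b * 2 ^ l)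
    (I : Finset ι) (a q l : ι → ℕ) (hq : ∀ i ∈ I, 0 < q i)
    (h : ∀ i ∈ I, ∀ j < l i, a i + q i * j < n) :
    traceCard S (I.biUnion fun i => progression (a i) (q i) (l i)) ≤
      b ^ I.card * 2 ^ (∑ i ∈ I, l i) := by
  classical
  induction I using Finset.induction_on with
  | empty => simpa using traceCard_le_one_of_eq (S := S) (A := ∅) (by simp)
  | insert i s hi ih =>
    rw [Finset.biUnion_insert, Finset.card_insert_of_notMem hi, Finset.sum_insert hi]
    have h1 := ih (fun i hi => hq i (by simp [hi])) fun i hi => h i (by simp [hi])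
    have h2 := traceCard_progression_le hS (h i (by simp))
    have h3 : l i ≤ n := by
      rcases Nat.eq_zero_or_pos (l i) with h0 | h0
      · omega
      · have h4 := h i (by simp) (l i - 1) (by omega)
        have h5 := Nat.le_mul_of_pos_left (l i - 1) (hq i (by simp))
        omega
    calc _ ≤ _ := traceCard_union_le_mul_traceCard _ _ _
      _ ≤ (b * 2 ^ l i) * (b ^ s.card * 2 ^ (∑ i ∈ s, l i)) :=
        Nat.mul_le_mul (h2.trans (hb _ h3)) h1
      _ = _ := by ring

lemma traceCard_range_le_of_progressions [Finite α] {ι : Type*} {S : Set (ℕ → α)} {n b : ℕ}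
    (hS : ∀ c ∈ S, RainbowFreeBelow n c) (hb : ∀ l ≤ n, rainbowFreeCount α l ≤ b * 2 ^ l)
    (I : Finset ι) (a q l : ι → ℕ) (hq : ∀ i ∈ I, 0 < q i)
    (h : ∀ i ∈ I, ∀ j < l i, a i + q i * j < n)
    (hdet : ∀ c ∈ S, ∀ c' ∈ S, (∀ i ∈ I, ∀ j < l i, c (a i + q i * j) = c' (a i + q i * j)) →
      ∀ x < n, c x = c' x) :
    traceCard S (Finset.range n) ≤ b ^ I.card * 2 ^ (∑ i ∈ I, l i) := by
  classical
  refine le_trans (traceCard_le_of_determined subset_rfl fun c hc c' hc' e x hx => ?_)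
    (traceCard_biUnion_progression_le hS hb I a q l hq h)
  refine hdet c hc c' hc' (fun i hi j hj => e _ ?_) x (by simpa using hx)
  exact Finset.mem_biUnion.2 ⟨i, hi, mem_progression.2 ⟨j, hj, rfl⟩⟩

/-- Colorings whose restriction below `w` is invariant under doubling the distance to `w`. -/
def doublingLeft (α : Type*) (n w : ℕ) : Set (ℕ → α) :=
  {c | RainbowFreeBelow n c ∧ ∀ d, 2 * d ≤ w → c (w - d) = c (w - 2 * d)}

/-- Colorings whose restriction to the interval `(w, m)` is invariant under doubling the distance
to `w`. -/
def doublingRight (α : Type*) (n m w : ℕ) : Set (ℕ → α) :=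
  {c | RainbowFreeBelow n c ∧ ∀ d, 1 ≤ d → w + 2 * d < m → c (w + d) = c (w + 2 * d)}

/-- Colorings that agree at the positions `o - d` and `o + d` for odd `d ≤ 2 k`. -/
def oddSymmetric (α : Type*) (n k o : ℕ) : Set (ℕ → α) :=
  {c | RainbowFreeBelow n c ∧ ∀ j < k, c (o + 1 + 2 * j) = c (o - 1 - 2 * j)}

/-- Colorings that are constant on the multiples of `2` of the form `2 (ρ + 6 j)`, `j < L`. -/
def constantOnClass (n L ρ : ℕ) (v : α) : Set (ℕ → α) :=
  {c | RainbowFreeBelow n c ∧ ∀ j < L, c (2 * (ρ + 6 * j)) = v}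

/-- Four consecutive even positions cannot all be left undetermined by the colors of the
progressions that start at even positions below `12 L`. -/
lemma exists_determined {L : ℕ} (c : ℕ → α) (M : ℕ)
    (h3 : ∀ A B, ∃ i < 6 * L, c (2 * i) ≠ A ∧ c (2 * i) ≠ B)
    (hcl : ∀ ρ < 6, ∀ v, ∃ j < L, c (2 * (ρ + 6 * j)) ≠ v)
    (X Y : Fin 4 → α)
    (hX : ∀ t : Fin 4, ∀ i < 6 * L, c (2 * i) = c (i + M + t) ∨ c (2 * i) = X t ∨ c (i + M + t) = X t)
    (hY : ∀ t : Fin 4, ∀ i < 6 * L, c (2 * i) = c (i + M + t) ∨ c (2 * i) = Y t ∨ c (i + M + t) = Y t) :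
    ∃ t, X t = Y t := by
  by_contra! hXY
  -- Three uses of `h3` give three distinct colors; the arguments of the first are arbitrary.
  obtain ⟨i₀, hi₀, -, -⟩ := h3 (c 0) (c 0)
  obtain ⟨i₁, hi₁, h10, -⟩ := h3 (c (2 * i₀)) (c (2 * i₀))
  obtain ⟨i₂, hi₂, h20, h21⟩ := h3 (c (2 * i₀)) (c (2 * i₁))
  have hs : ∀ t, ∃ s : Fin 3, c (2 * (![i₀, i₁, i₂] s)) ≠ X t ∧
      c (2 * (![i₀, i₁, i₂] s)) ≠ Y t := by
    intro t
    by_contra! hcon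
    have a0 := or_iff_not_imp_left.2 (hcon 0)
    have a1 := or_iff_not_imp_left.2 (hcon 1)
    have a2 := or_iff_not_imp_left.2 (hcon 2)
    simp only [Matrix.cons_val] at a0 a1 a2
    clear hX hY hcon hcl h3
    grind
  choose s hsX hsY using hs
  -- For each `t` one of the three colors avoids both `X t` and `Y t`; with four values of `t`, two
  -- of them share such a color `Z`.
  obtain ⟨t, t', htt, hst⟩ : ∃ t t' : Fin 4, t < t' ∧ s t = s t' := by
    obtain ⟨t, t', hne, he⟩ := Fintype.exists_ne_map_eq_of_card_lt s (by simp)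
    rcases lt_or_gt_of_ne hne with h | h
    · exact ⟨t, t', h, he⟩
    · exact ⟨t', t, h, he.symm⟩
  set Z := c (2 * (![i₀, i₁, i₂] (s t))) with hZ
  have hz : ![i₀, i₁, i₂] (s t) < 6 * L := by
    generalize s t = u
    fin_cases u <;> simpa
  -- If exactly one of the two positions had color `Z`, the other would have to equal both `X u` and
  -- `Y u`.
  have key : ∀ u, Z ≠ X u → Z ≠ Y u → ∀ i < 6 * L, (c (2 * i) = Z ↔ c (i + M + u) = Z) := by
    intro u h1 h2 i hi
    have := hX u i hi
    have := hY u i hi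
    have := hXY u
    grind
  have k1 := key t (hsX t) (hsY t)
  have k2 := key t' (by rw [hZ, hst]; exact hsX t') (by rw [hZ, hst]; exact hsY t')
  obtain ⟨δ, hδ, hδt⟩ : ∃ δ : ℕ, (δ = 1 ∨ δ = 2 ∨ δ = 3) ∧ (t' : ℕ) = t + δ :=
    ⟨t' - t, by omega, by omega⟩
  -- Both shifts read off the same set, so the occurrences of `Z` on even positions have period `δ`
  -- in `i`, hence period 6. A whole class mod 6 then has color `Z`, against `hcl`.
  have per : ∀ i, i + δ < 6 * L → (c (2 * i) = Z ↔ c (2 * (i + δ)) = Z) := by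
    intro i hi
    rw [k2 i (by omega), k1 (i + δ) hi, hδt]
    have : i + M + (t + δ) = i + δ + M + t := by omega
    rw [this]
  have per6 : ∀ i, i + 6 < 6 * L → (c (2 * i) = Z ↔ c (2 * (i + 6)) = Z) := by
    intro i hi
    rcases hδ with rfl | rfl | rfl
    · rw [per i (by omega), per (i + 1) (by omega), per (i + 1 + 1) (by omega),
        per (i + 1 + 1 + 1) (by omega), per (i + 1 + 1 + 1 + 1) (by omega),
        per (i + 1 + 1 + 1 + 1 + 1) (by omega)]
    · rw [per i (by omega), per (i + 2) (by omega), per (i + 2 + 2) (by omega)]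
    · rw [per i (by omega), per (i + 3) (by omega)]
  have perj : ∀ ρ < 6, ∀ j < L, (c (2 * ρ) = Z ↔ c (2 * (ρ + 6 * j)) = Z) := by
    intro ρ hρ j
    induction j with
    | zero => simp
    | succ j ih =>
      intro hj
      rw [ih (by omega), per6 (ρ + 6 * j) (by omega)]
      rfl
  set z := ![i₀, i₁, i₂] (s t)
  obtain ⟨j, hj, hne⟩ := hcl (z % 6) (Nat.mod_lt _ (by norm_num)) Z
  refine hne ((perj _ (Nat.mod_lt _ (by norm_num)) j hj).1 ?_)
  rw [perj _ (Nat.mod_lt _ (by norm_num)) (z / 6) (by omega), Nat.mod_add_div]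

/-- Colorings outside all structured families. -/
def genericColorings (α : Type*) (n L : ℕ) : Set (ℕ → α) :=
  {c | RainbowFreeBelow n c ∧
    (∀ w, 4 * L ≤ w → w < n → ∃ d, 2 * d ≤ w ∧ c (w - d) ≠ c (w - 2 * d)) ∧
    (∀ A B, ∃ i < 6 * L, c (2 * i) ≠ A ∧ c (2 * i) ≠ B) ∧
    ∀ ρ < 6, ∀ v, ∃ j < L, c (2 * (ρ + 6 * j)) ≠ v}

/-- The progressions `2 * i`, `i + M + t`, `2 * M + 2 * t` with `i < 6 * L` have their first two
terms in the prefix, because `M ≥ 6 * L + 3`. The index `t` may depend on the prefix. -/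
lemma exists_determined_of_prefix {n L M : ℕ} (hM : 6 * L + 3 ≤ M) (hMn : 2 * M + 8 ≤ n)
    {c : ℕ → α} (hc : c ∈ genericColorings α n L) :
    ∃ t < 4, ∀ c₁ ∈ genericColorings α n L, ∀ c₂ ∈ genericColorings α n L,
      (∀ x < 2 * M, c₁ x = c x) → (∀ x < 2 * M, c₂ x = c x) →
        c₁ (2 * M + 2 * t) = c₂ (2 * M + 2 * t) := by
  by_contra! hcon
  choose c₁ h₁ c₂ h₂ e₁ e₂ hne using fun t : Fin 4 => hcon t t.2
  have aux : ∀ c' ∈ genericColorings α n L, (∀ x < 2 * M, c' x = c x) → ∀ t : Fin 4,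
      ∀ i < 6 * L, c (2 * i) = c (i + M + t) ∨ c (2 * i) = c' (2 * M + 2 * t) ∨
        c (i + M + t) = c' (2 * M + 2 * t) := by
    intro c' hc' e t i hi
    rw [← e (2 * i) (by omega), ← e (i + M + t) (by omega)]
    exact hc'.1 _ _ _ (by omega) (by omega) (by omega) (by omega)
  obtain ⟨t, ht⟩ := exists_determined c M hc.2.2.1 hc.2.2.2
    (fun t : Fin 4 => c₁ t (2 * M + 2 * t)) (fun t : Fin 4 => c₂ t (2 * M + 2 * t))
    (fun t : Fin 4 => aux _ (h₁ t) (e₁ t) t)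
    (fun t : Fin 4 => aux _ (h₂ t) (e₂ t) t)
  exact hne t ht

/-! ### Each family saves a factor `2 ^ L` -/

variable [Finite α] {n b L : ℕ}

/-- Among the distances to `w` up to `4 * L`, the `L` that are 2 mod 4 are redundant: halving gives
an odd distance. -/
lemma traceCard_doublingLeft_le (hb : ∀ l ≤ n, rainbowFreeCount α l ≤ b * 2 ^ l) {w : ℕ}
    (hLw : 4 * L ≤ w) (hw : w < n) :
    traceCard (doublingLeft α n w) (Finset.range n) ≤ b ^ 4 * 2 ^ (n - L) := by
  have := traceCard_range_le_of_progressions (S := doublingLeft α n w) (fun c hc => hc.1) hb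
    (Finset.univ : Finset (Fin 4)) ![0, w - 4 * L, w - 4 * L + 1, w] ![1, 4, 2, 1]
    ![w - 4 * L, L, 2 * L, n - w] ?_ ?_ ?_
  · refine this.trans (le_of_eq ?_)
    simp only [Finset.card_univ, Fintype.card_fin, Fin.sum_univ_four, Matrix.cons_val]
    congr 2
    omega
  · simp [Fin.forall_fin_succ]
  · simp only [Finset.mem_univ, Fin.forall_fin_succ, Matrix.cons_val_zero, Matrix.cons_val_succ,
      IsEmpty.forall_iff, true_implies, and_true]
    refine ⟨?_, ?_, ?_, ?_⟩ <;> intro j hj <;> omega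
  · intro c hc c' hc' e x hx
    simp only [Finset.mem_univ, Fin.forall_fin_succ, Matrix.cons_val_zero, Matrix.cons_val_succ,
      IsEmpty.forall_iff, true_implies, and_true] at e
    obtain ⟨e1, e2, e3, e4⟩ := e
    by_cases h1 : x < w - 4 * L
    · convert e1 x h1 using 2 <;> omega
    by_cases h4 : w ≤ x
    · convert e4 (x - w) (by omega) using 2 <;> omega
    obtain ⟨y, rfl⟩ : ∃ y, x = w - 4 * L + y := ⟨x - (w - 4 * L), by omega⟩
    have h5 : y % 2 = 1 ∨ y % 4 = 0 ∨ y % 4 = 2 := by omega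
    rcases h5 with h5 | h5 | h5
    · convert e3 (y / 2) (by omega) using 2 <;> omega
    · convert e2 (y / 4) (by omega) using 2 <;> omega
    · have h6 := hc.2 ((4 * L - y) / 2) (by omega)
      have h7 := hc'.2 ((4 * L - y) / 2) (by omega)
      have h8 := e3 ((w - (4 * L - y) / 2 - (w - 4 * L + 1)) / 2) (by omega)
      rw [show w - 4 * L + 1 + 2 * ((w - (4 * L - y) / 2 - (w - 4 * L + 1)) / 2) =
        w - (4 * L - y) / 2 by omega] at h8
      rw [show w - 2 * ((4 * L - y) / 2) = w - 4 * L + y by omega] at h6 h7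
      rw [← h6, ← h7, h8]

lemma traceCard_doublingRight_le (hb : ∀ l ≤ n, rainbowFreeCount α l ≤ b * 2 ^ l) {w : ℕ}
    (hw : w < 4 * L) (hn : 8 * L ≤ n) :
    traceCard (doublingRight α n (8 * L) w) (Finset.range n) ≤ b ^ 4 * 2 ^ (n - L) := by
  have := traceCard_range_le_of_progressions (S := doublingRight α n (8 * L) w)
    (fun c hc => hc.1) hb
    (Finset.univ : Finset (Fin 4)) ![0, w + 1, w + 4, w + 4 * L + 1] ![1, 2, 4, 1]
    ![w + 1, 2 * L, L, n - w - 4 * L - 1] ?_ ?_ ?_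
  · refine this.trans (le_of_eq ?_)
    simp only [Finset.card_univ, Fintype.card_fin, Fin.sum_univ_four, Matrix.cons_val]
    congr 2
    omega
  · simp [Fin.forall_fin_succ]
  · simp only [Finset.mem_univ, Fin.forall_fin_succ, Matrix.cons_val_zero, Matrix.cons_val_succ,
      IsEmpty.forall_iff, true_implies, and_true]
    refine ⟨?_, ?_, ?_, ?_⟩ <;> intro j hj <;> omega
  · intro c hc c' hc' e x hx
    simp only [Finset.mem_univ, Fin.forall_fin_succ, Matrix.cons_val_zero, Matrix.cons_val_succ,
      IsEmpty.forall_iff, true_implies, and_true] at e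
    obtain ⟨e1, e2, e3, e4⟩ := e
    by_cases h1 : x < w + 1
    · convert e1 x h1 using 2 <;> omega
    by_cases h4 : w + 4 * L + 1 ≤ x
    · convert e4 (x - (w + 4 * L + 1)) (by omega) using 2 <;> omega
    obtain ⟨y, rfl⟩ : ∃ y, x = w + y := ⟨x - w, by omega⟩
    have h5 : y % 2 = 1 ∨ y % 4 = 0 ∨ y % 4 = 2 := by omega
    rcases h5 with h5 | h5 | h5
    · convert e2 (y / 2) (by omega) using 2 <;> omega
    · convert e3 (y / 4 - 1) (by omega) using 2 <;> omega
    · have h6 := hc.2 (y / 2) (by omega) (by omega)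
      have h7 := hc'.2 (y / 2) (by omega) (by omega)
      have h8 := e2 (y / 4) (by omega)
      rw [show w + 1 + 2 * (y / 4) = w + y / 2 by omega] at h8
      rw [show w + 2 * (y / 2) = w + y by omega] at h6 h7
      rw [← h6, ← h7, h8]

/-- Reflection in `o` makes `2 * L` positions to its right redundant; only `L` of this saving is
kept. -/
lemma traceCard_oddSymmetric_le (hb : ∀ l ≤ n, rainbowFreeCount α l ≤ b * 2 ^ l) {o : ℕ}
    (ho : 4 * L ≤ o) (hn : o + 4 * L < n) :
    traceCard (oddSymmetric α n (2 * L) o) (Finset.range n) ≤ b ^ 3 * 2 ^ (n - L) := by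
  have := traceCard_range_le_of_progressions (S := oddSymmetric α n (2 * L) o)
    (fun c hc => hc.1) hb
    (Finset.univ : Finset (Fin 3)) ![0, o + 2, o + 4 * L + 1] ![1, 2, 1]
    ![o + 1, 2 * L, n - o - 4 * L - 1] ?_ ?_ ?_
  · refine this.trans ?_
    simp only [Finset.card_univ, Fintype.card_fin, Fin.sum_univ_three, Matrix.cons_val]
    exact Nat.mul_le_mul_left _ (Nat.pow_le_pow_right two_pos (by omega))
  · simp [Fin.forall_fin_succ]
  · simp only [Finset.mem_univ, Fin.forall_fin_succ, Matrix.cons_val_zero, Matrix.cons_val_succ,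
      IsEmpty.forall_iff, true_implies, and_true]
    refine ⟨?_, ?_, ?_⟩ <;> intro j hj <;> omega
  · intro c hc c' hc' e x hx
    simp only [Finset.mem_univ, Fin.forall_fin_succ, Matrix.cons_val_zero, Matrix.cons_val_succ,
      IsEmpty.forall_iff, true_implies, and_true] at e
    obtain ⟨e1, e2, e3⟩ := e
    have e1' : ∀ y ≤ o, c y = c' y := by
      intro y hy
      convert e1 y (by omega) using 2 <;> omega
    by_cases h1 : x ≤ o
    · exact e1' x h1
    by_cases h4 : o + 4 * L + 1 ≤ x
    · convert e3 (x - (o + 4 * L + 1)) (by omega) using 2 <;> omega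
    obtain ⟨y, rfl⟩ : ∃ y, x = o + 1 + y := ⟨x - (o + 1), by omega⟩
    rcases Nat.even_or_odd' y with ⟨k, rfl | rfl⟩
    · rw [hc.2 k (by omega), hc'.2 k (by omega)]
      exact e1' _ (by omega)
    · convert e2 k (by omega) using 2 <;> omega

lemma traceCard_constantOnClass_le (hb : ∀ l ≤ n, rainbowFreeCount α l ≤ b * 2 ^ l) {ρ : ℕ}
    (hρ : ρ < 6) (hn : 12 * L ≤ n) (v : α) :
    traceCard (constantOnClass n L ρ v) (Finset.range n) ≤ b ^ 12 * 2 ^ (n - L) := by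
  have hmem : 2 * ρ ∈ Finset.range 13 := by simp; omega
  have := traceCard_range_le_of_progressions (S := constantOnClass n L ρ v)
    (fun c hc => hc.1) hb ((Finset.range 13).erase (2 * ρ))
    -- Indices below 12 are the residue classes mod 12 below `12 * L`; index 12 is the remaining
    -- tail.
    (fun s => if s < 12 then s else 12 * L) (fun s => if s < 12 then 12 else 1)
    (fun s => if s < 12 then L else n - 12 * L) ?_ ?_ ?_
  · refine this.trans (le_of_eq ?_)
    rw [Finset.card_erase_of_mem hmem, Finset.card_range]
    have h1 := Finset.add_sum_erase (Finset.range 13)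
      (fun s => if s < 12 then L else n - 12 * L) hmem
    have h2 : (∑ s ∈ Finset.range 13, if s < 12 then L else n - 12 * L) = n := by
      simp [Finset.sum_range_succ]
      omega
    rw [h2] at h1
    simp only [show 2 * ρ < 12 by omega, if_true] at h1
    congr 2
    omega
  · intro s _
    split_ifs <;> norm_num
  · intro s hs j hj
    split_ifs at hj ⊢ <;> omega
  · intro c hc c' hc' e x hx
    by_cases h1 : x < 12 * L
    · by_cases h2 : x % 12 = 2 * ρ
      · have h3 := hc.2 (x / 12) (by omega)
        have h4 := hc'.2 (x / 12) (by omega)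
        rw [show 2 * (ρ + 6 * (x / 12)) = x by omega] at h3 h4
        rw [h3, h4]
      · have h3 : x % 12 < 12 := Nat.mod_lt _ (by norm_num)
        have h4 := e (x % 12) (by simp [h2]; omega) (x / 12) (by simp only [h3, if_true]; omega)
        simp only [h3, if_true] at h4
        rwa [Nat.mod_add_div] at h4
    · have h4 := e 12 (by simp; omega) (x - 12 * L) (by simp; omega)
      simp only [lt_irrefl, if_false, one_mul] at h4
      rwa [Nat.add_sub_cancel' (by omega)] at h4

lemma traceCard_genericColorings_step {M : ℕ} (hM : 6 * L + 3 ≤ M) (hMn : 2 * M + 8 ≤ n) :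
    traceCard (genericColorings α n L) (Finset.range (2 * M + 8)) ≤
      traceCard (genericColorings α n L) (Finset.range (2 * M)) * 2 ^ 7 := by
  -- Adding the whole longer range, not just the new block, lets the count start from the fixed
  -- prefix, which has a single trace.
  have hun : Finset.range (2 * M + 8) = Finset.range (2 * M) ∪ Finset.range (2 * M + 8) :=
    (Finset.union_eq_right.2 (Finset.range_mono (by omega))).symm
  rw [hun]
  refine traceCard_union_le_mul _ _ _ _ fun c hc => ?_
  obtain ⟨t, ht, hdet⟩ := exists_determined_of_prefix hM hMn hc
  set S := {c' ∈ genericColorings α n L | ∀ x ∈ Finset.range (2 * M), c' x = c x} with hS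
  have h0 : traceCard S (Finset.range (2 * M)) ≤ 1 :=
    traceCard_le_one_of_eq fun c₁ h₁ c₂ h₂ x hx => by rw [h₁.2 x hx, h₂.2 x hx]
  have hstep : ∀ i < 8, traceCard S (Finset.range (2 * M + i + 1)) ≤
      traceCard S (Finset.range (2 * M + i)) * 2 := fun i hi =>
    traceCard_range_succ_le_two_mul (n := n) (by omega) (fun c hc => hc.1.1)
      fun c hc => hc.1.2.1 _ (by omega) (by omega)
  have hdet' : traceCard S (Finset.range (2 * M + 2 * t + 1)) ≤
      traceCard S (Finset.range (2 * M + 2 * t)) * 1 :=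
    traceCard_range_succ_le _ _ _ fun c' _ => traceCard_le_one_of_eq fun c₁ h₁ c₂ h₂ x hx => by
      rw [Finset.mem_singleton.1 hx]
      exact hdet c₁ h₁.1.1 c₂ h₂.1.1 (fun x hx => h₁.1.2 x (by simpa using hx))
        fun x hx => h₂.1.2 x (by simpa using hx)
  have s0 := hstep 0 (by omega)
  have s1 := hstep 1 (by omega)
  have s2 := hstep 2 (by omega)
  have s3 := hstep 3 (by omega)
  have s4 := hstep 4 (by omega)
  have s5 := hstep 5 (by omega)
  have s6 := hstep 6 (by omega)
  have s7 := hstep 7 (by omega)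
  simp only [add_assoc, Nat.reduceAdd, add_zero] at s0 s1 s2 s3 s4 s5 s6 s7 hdet'
  interval_cases t <;> simp only [Nat.reduceMul, Nat.reduceAdd, add_zero] at hdet' <;> omega

/-- The `L` blocks occupy the positions from `12 * L + 8` to `20 * L + 8`, which fit in `28 * L`
since `L ≥ 1`. -/
lemma traceCard_genericColorings_le (hb : ∀ l ≤ n, rainbowFreeCount α l ≤ b * 2 ^ l)
    (hL : 1 ≤ L) (hn : 28 * L ≤ n) :
    traceCard (genericColorings α n L) (Finset.range n) ≤ b ^ 2 * 2 ^ (n - L) := by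
  have hRF : ∀ c ∈ genericColorings α n L, RainbowFreeBelow n c := fun c hc => hc.1
  have key : ∀ s ≤ L, traceCard (genericColorings α n L) (Finset.range (12 * L + 8 + 8 * s)) ≤
      b * 2 ^ (12 * L + 8) * 2 ^ (7 * s) := by
    intro s
    induction s with
    | zero =>
      intro _
      have h := (traceCard_range_le hRF (m := 12 * L + 8) (by omega)).trans (hb _ (by omega))
      simpa using h
    | succ s ih =>
      intro hs
      have h1 := traceCard_genericColorings_step (α := α) (n := n) (L := L)
        (M := 6 * L + 4 + 4 * s) (by omega) (by omega)
      rw [show 2 * (6 * L + 4 + 4 * s) + 8 = 12 * L + 8 + 8 * (s + 1) by ring,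
        show 2 * (6 * L + 4 + 4 * s) = 12 * L + 8 + 8 * s by ring] at h1
      calc _ ≤ _ := h1
        _ ≤ b * 2 ^ (12 * L + 8) * 2 ^ (7 * s) * 2 ^ 7 := Nat.mul_le_mul_right _ (ih (by omega))
        _ = _ := by ring
  have h1 := key L le_rfl
  have h2 := (traceCard_progression_le hRF (a := 20 * L + 8) (q := 1) (l := n - (20 * L + 8))
    (fun i hi => by omega)).trans (hb _ (by omega))
  have h3 : traceCard (genericColorings α n L) (Finset.range n) ≤
      traceCard (genericColorings α n L) (Finset.range (12 * L + 8 + 8 * L) ∪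
        progression (20 * L + 8) 1 (n - (20 * L + 8))) := by
    refine traceCard_mono subset_rfl fun x hx => ?_
    have hx' : x < n := by simpa using hx
    rw [Finset.mem_union, Finset.mem_range]
    by_cases hlt : x < 12 * L + 8 + 8 * L
    · exact Or.inl hlt
    · exact Or.inr (mem_progression.2 ⟨x - (20 * L + 8), by omega, by omega⟩)
  calc _ ≤ _ := h3.trans (traceCard_union_le_mul_traceCard _ _ _)
    _ ≤ b * 2 ^ (12 * L + 8) * 2 ^ (7 * L) * (b * 2 ^ (n - (20 * L + 8))) := Nat.mul_le_mul h1 h2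
    _ = b ^ 2 * 2 ^ (12 * L + 8 + 7 * L + (n - (20 * L + 8))) := by ring
    _ = _ := by
      congr 2
      omega

end Cases

/-! ### Colorings with at least three colors are negligible -/

section Counting

variable {α : Type*}

/-- Rainbow 3-AP-free colorings of `{0, …, n - 1}` that use at least three colors. -/
def threeColored (α : Type*) (n : ℕ) : Set (ℕ → α) :=
  {c | RainbowFreeBelow n c ∧ ∀ A B, ∃ x < n, c x ≠ A ∧ c x ≠ B}

lemma threeColored_subset {n L : ℕ} (hn : 28 * L ≤ n) [Fintype α] :
    threeColored α n ⊆ (⋃ w ∈ Finset.Ico (4 * L) n, doublingLeft α n w) ∪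
      (⋃ w ∈ Finset.range (4 * L), doublingRight α n (8 * L) w) ∪
      (⋃ o ∈ Finset.Ico (4 * L) (8 * L), oddSymmetric α n (2 * L) o) ∪
      (⋃ p ∈ Finset.range 6 ×ˢ (Finset.univ : Finset α), constantOnClass n L p.1 p.2) ∪
      genericColorings α n L := by
  intro c ⟨hRF, h3⟩
  simp only [Set.mem_union, Set.mem_iUnion, Finset.mem_Ico, Finset.mem_range, exists_prop]
  by_cases hdl : ∃ w, (4 * L ≤ w ∧ w < n) ∧ ∀ d, 2 * d ≤ w → c (w - d) = c (w - 2 * d)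
  · obtain ⟨w, hw, h⟩ := hdl
    exact Or.inl (Or.inl (Or.inl (Or.inl ⟨w, hw, hRF, h⟩)))
  push Not at hdl
  -- Otherwise the first position outside `{A, B}` is at least `4 * L`, and failure of left doubling
  -- there puts two distinct earlier colors in a rainbow progression with it.
  have hstart : ∀ A B, ∃ x < 4 * L, c x ≠ A ∧ c x ≠ B := by
    intro A B
    by_contra! hcon
    classical
    have hex := h3 A B
    obtain ⟨hw, hwA, hwB⟩ := Nat.find_spec hex
    have hmin : ∀ x < Nat.find hex, c x = A ∨ c x = B := by
      intro x hx
      have := Nat.find_min hex hx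
      by_contra! h
      exact this ⟨by omega, h⟩
    set w := Nat.find hex
    have hwL : 4 * L ≤ w := by
      by_contra! h
      exact hwB (hcon w h hwA)
    obtain ⟨d, hd, hne⟩ := hdl w ⟨hwL, hw⟩
    have hd0 : d ≠ 0 := by rintro rfl; simp at hne
    have h1 := hmin (w - d) (by omega)
    have h2 := hmin (w - 2 * d) (by omega)
    have := hRF (w - 2 * d) (w - d) w (by omega) (by omega) hw (by omega)
    grind
  by_cases hev : ∃ A B, ∀ i < 6 * L, c (2 * i) = A ∨ c (2 * i) = B
  · obtain ⟨A, B, hAB⟩ := hev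
    -- A third color at such an `o` forces `o` odd, and positions at odd distance from it are even,
    -- so mirror images must agree.
    by_cases ho : ∃ o, (4 * L ≤ o ∧ o < 8 * L) ∧ c o ≠ A ∧ c o ≠ B
    · obtain ⟨o, ho, hoA, hoB⟩ := ho
      refine Or.inl (Or.inl (Or.inr ⟨o, ho, hRF, fun j hj => ?_⟩))
      have hodd : o % 2 = 1 := by
        by_contra h
        have := hAB (o / 2) (by omega)
        rw [show 2 * (o / 2) = o by omega] at this
        tauto
      have h1 := hAB ((o + 1 + 2 * j) / 2) (by omega)
      have h2 := hAB ((o - 1 - 2 * j) / 2) (by omega)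
      rw [show 2 * ((o + 1 + 2 * j) / 2) = o + 1 + 2 * j by omega] at h1
      rw [show 2 * ((o - 1 - 2 * j) / 2) = o - 1 - 2 * j by omega] at h2
      have := hRF (o - 1 - 2 * j) o (o + 1 + 2 * j) (by omega) (by omega) (by omega) (by omega)
      grind
    · push Not at ho
      classical
      obtain ⟨x, hx, hxA, hxB⟩ := hstart A B
      -- The last third-colored position before `4 * L` has only `A` and `B` after it up to `8 * L`,
      -- which forces right doubling.
      set P : ℕ → Prop := fun x => c x ≠ A ∧ c x ≠ B
      have hP : P (Nat.findGreatest P (4 * L - 1)) :=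
        Nat.findGreatest_spec (m := x) (by omega) ⟨hxA, hxB⟩
      have hle := Nat.findGreatest_le (P := P) (4 * L - 1)
      have hgr : ∀ y, Nat.findGreatest P (4 * L - 1) < y → y < 8 * L → c y = A ∨ c y = B := by
        intro y hy hy8
        by_contra! hcon
        by_cases h4 : 4 * L ≤ y
        · exact hcon.2 (ho y ⟨h4, hy8⟩ hcon.1)
        · exact Nat.findGreatest_is_greatest hy (by omega) hcon
      set w := Nat.findGreatest P (4 * L - 1)
      refine Or.inl (Or.inl (Or.inl (Or.inr ⟨w, by omega, hRF, fun d hd hdw => ?_⟩)))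
      have h1 := hgr (w + d) (by omega) (by omega)
      have h2 := hgr (w + 2 * d) (by omega) hdw
      have := hRF w (w + d) (w + 2 * d) (by omega) (by omega) (by omega) (by omega)
      obtain ⟨hPA, hPB⟩ := hP
      grind
  push Not at hev
  by_cases hcl : ∃ ρ < 6, ∃ v, ∀ j < L, c (2 * (ρ + 6 * j)) = v
  · obtain ⟨ρ, hρ, v, h⟩ := hcl
    exact Or.inl (Or.inr ⟨(ρ, v), by simpa using hρ, hRF, h⟩)
  push Not at hcl
  exact Or.inr ⟨hRF, fun w h1 h2 => hdl w ⟨h1, h2⟩, hev, hcl⟩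

lemma traceCard_threeColored_le [Fintype α] {n L b : ℕ} (hb1 : 1 ≤ b)
    (hb : ∀ l ≤ n, rainbowFreeCount α l ≤ b * 2 ^ l) (hL : 1 ≤ L) (hn : 28 * L ≤ n) :
    traceCard (threeColored α n) (Finset.range n) ≤
      (3 * n + 6 * Fintype.card α + 1) * (b ^ 12 * 2 ^ (n - L)) := by
  have hpow : ∀ k ≤ 12, b ^ k * 2 ^ (n - L) ≤ b ^ 12 * 2 ^ (n - L) := fun k hk =>
    Nat.mul_le_mul_right _ (Nat.pow_le_pow_right hb1 hk)
  set Q := b ^ 12 * 2 ^ (n - L)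
  have h1 : traceCard (⋃ w ∈ Finset.Ico (4 * L) n, doublingLeft α n w) (Finset.range n) ≤ n * Q :=
    (traceCard_biUnion_le _ _ _ Q fun w hw => (traceCard_doublingLeft_le hb
      (Finset.mem_Ico.1 hw).1 (Finset.mem_Ico.1 hw).2).trans (hpow 4 (by norm_num))).trans
      (Nat.mul_le_mul_right _ (by simp))
  have h2 : traceCard (⋃ w ∈ Finset.range (4 * L), doublingRight α n (8 * L) w)
      (Finset.range n) ≤ n * Q :=
    (traceCard_biUnion_le _ _ _ Q fun w hw => (traceCard_doublingRight_le hb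
      (Finset.mem_range.1 hw) (by omega)).trans (hpow 4 (by norm_num))).trans
      (Nat.mul_le_mul_right _ (by simp; omega))
  have h3 : traceCard (⋃ o ∈ Finset.Ico (4 * L) (8 * L), oddSymmetric α n (2 * L) o)
      (Finset.range n) ≤ n * Q :=
    (traceCard_biUnion_le _ _ _ Q fun o ho => by
      rw [Finset.mem_Ico] at ho
      exact (traceCard_oddSymmetric_le hb ho.1 (by omega)).trans (hpow 3 (by norm_num))).trans
      (Nat.mul_le_mul_right _ (by simp; omega))
  have h4 : traceCard (⋃ p ∈ Finset.range 6 ×ˢ (Finset.univ : Finset α),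
      constantOnClass n L p.1 p.2) (Finset.range n) ≤ (6 * Fintype.card α) * Q :=
    (traceCard_biUnion_le _ _ _ Q fun p hp => by
      simp only [Finset.mem_product, Finset.mem_range] at hp
      exact traceCard_constantOnClass_le hb hp.1 (by omega) p.2).trans
      (Nat.mul_le_mul_right _ (by simp))
  have h5 := (traceCard_genericColorings_le hb hL hn).trans (hpow 2 (by norm_num))
  refine (traceCard_mono (threeColored_subset hn) subset_rfl).trans ?_
  refine (traceCard_union_le _ _ _).trans ?_
  have u1 := traceCard_union_le (α := α) ((⋃ w ∈ Finset.Ico (4 * L) n, doublingLeft α n w) ∪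
      (⋃ w ∈ Finset.range (4 * L), doublingRight α n (8 * L) w) ∪
      (⋃ o ∈ Finset.Ico (4 * L) (8 * L), oddSymmetric α n (2 * L) o))
      (⋃ p ∈ Finset.range 6 ×ˢ (Finset.univ : Finset α), constantOnClass n L p.1 p.2)
      (Finset.range n)
  have u2 := traceCard_union_le (α := α) ((⋃ w ∈ Finset.Ico (4 * L) n, doublingLeft α n w) ∪
      (⋃ w ∈ Finset.range (4 * L), doublingRight α n (8 * L) w))
      (⋃ o ∈ Finset.Ico (4 * L) (8 * L), oddSymmetric α n (2 * L) o) (Finset.range n)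
  have u3 := traceCard_union_le (α := α) (⋃ w ∈ Finset.Ico (4 * L) n, doublingLeft α n w)
      (⋃ w ∈ Finset.range (4 * L), doublingRight α n (8 * L) w) (Finset.range n)
  nlinarith

lemma tendsto_traceCard_threeColored (α : Type*) [Fintype α] :
    Tendsto (fun n : ℕ => (traceCard (threeColored α n) (Finset.range n) : ℝ) / 2 ^ n)
      atTop (𝓝 0) := by
  obtain ⟨C, hC, hT⟩ := exists_rainbowFreeCount_le α
  -- From `n ≤ 28 * (L + 1)`: the number of families is at most `(85 + 6 r)(L + 1)` and `b = C * (n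
  -- + 1)` is at most `29 * C * (L + 1)`, so the total degree in `L + 1` is 13.
  set K : ℝ := (85 + 6 * Fintype.card α) * (29 * C) ^ 12
  have hlim : Tendsto (fun L : ℕ => K * (2 * ((((L + 1 : ℕ) : ℝ)) ^ 13 / 2 ^ (L + 1))))
      atTop (𝓝 0) := by
    have h := (tendsto_pow_const_div_const_pow_of_one_lt 13 (one_lt_two (α := ℝ))).comp
      (tendsto_add_atTop_nat 1)
    simpa using (h.const_mul 2).const_mul K
  have hdiv : Tendsto (fun n : ℕ => n / 28) atTop atTop :=
    Nat.tendsto_div_const_atTop (by norm_num)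
  refine squeeze_zero' (Eventually.of_forall fun n => by positivity) ?_ (hlim.comp hdiv)
  filter_upwards [eventually_ge_atTop 28] with n hn
  set L := n / 28 with hLdef
  have h := traceCard_threeColored_le (α := α) (n := n) (L := L) (b := C * (n + 1))
    (Nat.mul_pos hC (Nat.succ_pos n)) (fun l hl => (hT l).trans (by gcongr)) (by omega) (by omega)
  have hnL : (n : ℝ) ≤ 28 * (L + 1) := by
    have : n ≤ 28 * (L + 1) := by omega
    exact_mod_cast this
  have hpow : (2 : ℝ) ^ n = 2 ^ (n - L) * 2 ^ L := by
    rw [← pow_add]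
    congr 1
    omega
  have h' : (traceCard (threeColored α n) (Finset.range n) : ℝ) ≤
      (3 * n + 6 * Fintype.card α + 1) * ((C * (n + 1)) ^ 12 * 2 ^ (n - L)) := by
    exact_mod_cast h
  simp only [Function.comp_apply]
  push_cast
  rw [div_le_iff₀ (by positivity), hpow]
  have hL0 : (0 : ℝ) ≤ L := by positivity
  have hcard : (0 : ℝ) ≤ Fintype.card α := by positivity
  calc _ ≤ _ := h'
    _ ≤ ((85 + 6 * Fintype.card α) * (L + 1)) *
        ((C * (29 * (L + 1))) ^ 12 * 2 ^ (n - L)) := by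
      gcongr
      · nlinarith
      · linarith
    _ = _ := by
      simp only [K]
      field_simp
      ring

end Counting

/-! ### Transfer to `[n]` and the count of two-colorings -/

section Interval

variable {r : ℕ}

lemma rainbowThreeAPFree_of_two_colors {A : Finset ℕ} {c : A → Fin r}
    (h : (Set.range c).ncard ≤ 2) : RainbowThreeAPFree c := by
  classical
  rintro x y z - ⟨hxy, hxz, hyz⟩
  have h1 : (({c x, c y, c z} : Finset (Fin r)) : Set (Fin r)) ⊆ Set.range c := by
    intro v hv
    simp only [Finset.coe_insert, Finset.coe_singleton, Set.mem_insert_iff,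
      Set.mem_singleton_iff] at hv
    rcases hv with rfl | rfl | rfl <;> exact ⟨_, rfl⟩
  have h2 := Set.ncard_le_ncard h1 (Set.toFinite _)
  rw [Set.ncard_coe_finset, Finset.card_eq_three.2 ⟨_, _, _, hxy, hxz, hyz, rfl⟩] at h2
  omega

lemma ncard_manyColored_le (hr : 0 < r) (n : ℕ) :
    {c : intInterval n → Fin r | RainbowThreeAPFree c ∧ ¬ (Set.range c).ncard ≤ 2}.ncard ≤
      traceCard (threeColored (Fin r) n) (Finset.range n) := by
  classical
  have hmem : ∀ x < n, x + 1 ∈ intInterval n := fun x hx => by simp [intInterval]; omega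
  -- Shift by one to start at 0; the default color outside the interval plays no role.
  let f : (intInterval n → Fin r) → ℕ → Fin r := fun c x =>
    if h : x + 1 ∈ intInterval n then c ⟨x + 1, h⟩ else ⟨0, hr⟩
  have hf : ∀ c x (h : x < n), f c x = c ⟨x + 1, hmem x h⟩ := fun c x h => dif_pos (hmem x h)
  have hsurj : ∀ p : intInterval n, ∃ x, ∃ h : x < n, p = ⟨x + 1, hmem x h⟩ := by
    rintro ⟨p, hp⟩
    have hp' := hp
    simp only [intInterval, Finset.mem_Icc] at hp'
    exact ⟨p - 1, by omega, Subtype.ext (by simp; omega)⟩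
  refine Set.ncard_le_ncard_of_injOn (fun c (x : Finset.range n) => f c x) ?_ ?_ (Set.toFinite _)
  · rintro c ⟨hc, hc3⟩
    refine ⟨f c, ⟨?_, ?_⟩, rfl⟩
    · have key : ∀ x d, 0 < d → ∀ hx : x + 2 * d < n,
          f c x = f c (x + d) ∨ f c x = f c (x + 2 * d) ∨ f c (x + d) = f c (x + 2 * d) := by
        intro x d hd hx
        have := hc ⟨x + 1, hmem x (by omega)⟩ ⟨x + d + 1, hmem _ (by omega)⟩
          ⟨x + 2 * d + 1, hmem _ (by omega)⟩ ⟨d, hd, by simp; omega, by simp; omega⟩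
        rw [hf c x (by omega), hf c (x + d) (by omega), hf c (x + 2 * d) (by omega)]
        tauto
      intro x y z hx hy hz e
      rcases lt_trichotomy x y with h | h | h
      · obtain ⟨d, rfl⟩ := Nat.exists_eq_add_of_lt h
        obtain rfl : z = x + 2 * (d + 1) := by omega
        exact key x (d + 1) (by omega) hz
      · exact Or.inl (by rw [h])
      · obtain ⟨d, rfl⟩ : ∃ d, y = z + d := ⟨y - z, by omega⟩
        obtain rfl : x = z + 2 * d := by omega
        have := key z d (by omega) hx
        tauto
    · intro A B
      by_contra! hcon
      apply hc3
      have hsub : Set.range c ⊆ {A, B} := by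
        rintro v ⟨p, rfl⟩
        obtain ⟨x, hx, rfl⟩ := hsurj p
        have := hcon x hx
        rw [hf c x hx] at this
        simp only [Set.mem_insert_iff, Set.mem_singleton_iff]
        tauto
      refine (Set.ncard_le_ncard hsub (Set.toFinite _)).trans ?_
      exact (Set.ncard_insert_le _ _).trans (by simp)
  · intro c _ c' _ e
    funext p
    obtain ⟨x, hx, rfl⟩ := hsurj p
    have := congrFun e ⟨x, by simpa using hx⟩
    simpa only [hf _ x hx] using this

lemma numRainbowFree_le (hr : 0 < r) (n : ℕ) :
    numRainbowFree r (intInterval n) ≤ numRainbowFreeTwoColored r (intInterval n) +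
      traceCard (threeColored (Fin r) n) (Finset.range n) := by
  refine le_trans ?_ (Nat.add_le_add_left (ncard_manyColored_le hr n) _)
  refine le_trans (Set.ncard_le_ncard (fun c hc => ?_) (Set.toFinite _)) (Set.ncard_union_le _ _)
  by_cases h : (Set.range c).ncard ≤ 2
  · exact Or.inl ⟨hc, h⟩
  · exact Or.inr ⟨hc, h⟩

lemma numRainbowFreeTwoColored_le_numRainbowFree (A : Finset ℕ) :
    numRainbowFreeTwoColored r A ≤ numRainbowFree r A :=
  Set.ncard_le_ncard (fun _ hc => hc.1) (Set.toFinite _)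

lemma numRainbowFreeTwoColored_le (hr : 2 ≤ r) (A : Finset ℕ) :
    numRainbowFreeTwoColored r A ≤ r.choose 2 * 2 ^ A.card := by
  classical
  have hsub : {c : A → Fin r | RainbowThreeAPFree c ∧ (Set.range c).ncard ≤ 2} ⊆
      (((Finset.univ : Finset (Fin r)).powersetCard 2).biUnion fun s =>
        Fintype.piFinset fun _ : A => s : Finset (A → Fin r)) := by
    rintro c ⟨-, hc⟩
    rw [← Set.image_univ, ← Finset.coe_univ, ← Finset.coe_image, Set.ncard_coe_finset] at hc
    obtain ⟨s, hs, hs2⟩ := Finset.exists_superset_card_eq hc (by simpa using hr)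
    simp only [Finset.coe_biUnion, Set.mem_iUnion, Finset.mem_coe, Finset.mem_powersetCard,
      Fintype.mem_piFinset]
    exact ⟨s, ⟨Finset.subset_univ _, hs2⟩, fun x => hs (by simp)⟩
  refine (Set.ncard_le_ncard hsub (Set.toFinite _)).trans ?_
  rw [Set.ncard_coe_finset]
  refine (Finset.card_biUnion_le_card_mul _ _ (2 ^ A.card) fun s hs => ?_).trans (by simp)
  simp [(Finset.mem_powersetCard.1 hs).2]

/-- For each pair of colors the nonconstant maps into it use exactly that pair, so distinct pairs
give disjoint sets. -/
lemma le_numRainbowFreeTwoColored (A : Finset ℕ) :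
    r.choose 2 * (2 ^ A.card - 2) ≤ numRainbowFreeTwoColored r A := by
  classical
  let P : Finset (Fin r) → Finset (A → Fin r) := fun s =>
    (Fintype.piFinset fun _ : A => s) \ s.image fun v _ => v
  have hcard : ∀ s ∈ (Finset.univ : Finset (Fin r)).powersetCard 2,
      2 ^ A.card - 2 ≤ (P s).card := by
    intro s hs
    have hs2 := (Finset.mem_powersetCard.1 hs).2
    have h1 : (Fintype.piFinset fun _ : A => s).card = 2 ^ A.card := by simp [hs2]
    have h2 : _ ≤ (P s).card :=
      Finset.le_card_sdiff (s.image fun v (_ : A) => v) (Fintype.piFinset fun _ : A => s)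
    have h3 : (s.image fun v (_ : A) => v).card ≤ 2 := hs2 ▸ Finset.card_image_le
    omega
  have hpair : ∀ s ∈ (Finset.univ : Finset (Fin r)).powersetCard 2, ∀ c ∈ P s,
      s = Finset.univ.image c := by
    intro s hs c hc
    have hs2 := (Finset.mem_powersetCard.1 hs).2
    simp only [P, Finset.mem_sdiff, Fintype.mem_piFinset, Finset.mem_image, not_exists,
      not_and] at hc
    symm
    refine Finset.eq_of_subset_of_card_le (fun v hv => ?_) ?_
    · obtain ⟨x, -, rfl⟩ := Finset.mem_image.1 hv
      exact hc.1 x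
    · by_contra! hlt
      have h1 := Finset.card_le_one.1 (show (Finset.univ.image c).card ≤ 1 by omega)
      rcases isEmpty_or_nonempty A with hA | ⟨⟨x⟩⟩
      · obtain ⟨v, hv⟩ := Finset.card_pos.1 (show 0 < s.card by omega)
        exact hc.2 v hv (Subsingleton.elim _ _)
      · exact hc.2 (c x) (hc.1 x) (funext fun y => h1 _ (by simp) _ (by simp))
  have hdisj : Set.PairwiseDisjoint
      (((Finset.univ : Finset (Fin r)).powersetCard 2 : Finset _) : Set (Finset (Fin r))) P := by
    intro s hs s' hs' hne
    refine Finset.disjoint_left.2 fun c hc hc' => hne ?_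
    rw [hpair s hs c hc, ← hpair s' hs' c hc']
  have hsub : ((((Finset.univ : Finset (Fin r)).powersetCard 2).biUnion P : Finset _) :
      Set (A → Fin r)) ⊆ {c : A → Fin r | RainbowThreeAPFree c ∧ (Set.range c).ncard ≤ 2} := by
    intro c hc
    obtain ⟨s, hs, hcs⟩ := Finset.mem_biUnion.1 (Finset.mem_coe.1 hc)
    have h2 : (Set.range c).ncard ≤ 2 := by
      rw [← Set.image_univ, ← Finset.coe_univ, ← Finset.coe_image, Set.ncard_coe_finset,
        ← hpair s hs c hcs]
      exact (Finset.mem_powersetCard.1 hs).2.le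
    exact ⟨rainbowThreeAPFree_of_two_colors h2, h2⟩
  refine le_trans ?_ (Set.ncard_le_ncard hsub (Set.toFinite _))
  rw [Set.ncard_coe_finset, Finset.card_biUnion hdisj]
  have := Finset.card_nsmul_le_sum _ _ _ hcard
  simpa using this

end Interval

/-! ### The two limits -/

theorem mainTheorem4 (r : ℕ) (hr : 3 ≤ r) :
    (∃ ε : ℕ → ℝ, Tendsto ε atTop (𝓝 0) ∧
      ∀ n : ℕ, (numRainbowFree r (intInterval n) : ℝ) = ((r.choose 2 : ℝ) + ε n) * 2 ^ n) ∧
    Tendsto (fun n : ℕ => (numRainbowFreeTwoColored r (intInterval n) : ℝ) /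
        (numRainbowFree r (intInterval n) : ℝ)) atTop (𝓝 1) := by
  have hcard : ∀ n, (intInterval n).card = n := fun n => by simp [intInterval]
  have hC : (r.choose 2 : ℝ) ≠ 0 := by
    exact_mod_cast (Nat.choose_pos (by omega : 2 ≤ r)).ne'
  have hlow : ∀ n : ℕ, (r.choose 2 : ℝ) - 2 * r.choose 2 * (1 / 2) ^ n ≤
      numRainbowFreeTwoColored r (intInterval n) / 2 ^ n := by
    intro n
    have h := le_numRainbowFreeTwoColored (r := r) (intInterval n)
    rw [hcard] at h
    have h1 : r.choose 2 * 2 ^ n ≤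
        numRainbowFreeTwoColored r (intInterval n) + r.choose 2 * 2 := by
      calc r.choose 2 * 2 ^ n ≤ r.choose 2 * ((2 ^ n - 2) + 2) :=
            Nat.mul_le_mul_left _ (by omega)
        _ ≤ _ := by
          rw [Nat.mul_add]
          omega
    have h2 : (r.choose 2 : ℝ) * 2 ^ n ≤
        numRainbowFreeTwoColored r (intInterval n) + r.choose 2 * 2 := by exact_mod_cast h1
    rw [le_div_iff₀ (by positivity), sub_mul, mul_assoc, ← mul_pow]
    norm_num
    linarith
  have hup : ∀ n : ℕ, (numRainbowFreeTwoColored r (intInterval n) : ℝ) / 2 ^ n ≤ r.choose 2 := by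
    intro n
    have h := numRainbowFreeTwoColored_le (by omega : 2 ≤ r) (intInterval n)
    rw [hcard] at h
    rw [div_le_iff₀ (by positivity)]
    exact_mod_cast h
  have htwo : Tendsto (fun n : ℕ => (numRainbowFreeTwoColored r (intInterval n) : ℝ) / 2 ^ n)
      atTop (𝓝 (r.choose 2)) := by
    refine tendsto_of_tendsto_of_tendsto_of_le_of_le ?_ tendsto_const_nhds hlow hup
    have := (tendsto_pow_atTop_nhds_zero_of_lt_one (r := (1 / 2 : ℝ)) (by norm_num)
      (by norm_num)).const_mul (2 * (r.choose 2 : ℝ))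
    simpa using tendsto_const_nhds.sub this
  have hall : Tendsto (fun n : ℕ => (numRainbowFree r (intInterval n) : ℝ) / 2 ^ n)
      atTop (𝓝 (r.choose 2)) := by
    have h := htwo.add (tendsto_traceCard_threeColored (Fin r))
    rw [add_zero] at h
    refine tendsto_of_tendsto_of_tendsto_of_le_of_le htwo h (fun n => ?_) fun n => ?_
    · have := numRainbowFreeTwoColored_le_numRainbowFree (r := r) (intInterval n)
      dsimp only
      gcongr
    · dsimp only
      rw [← add_div]
      have h1 := numRainbowFree_le (by omega : 0 < r) n
      gcongr
      exact_mod_cast h1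
  refine ⟨⟨fun n => (numRainbowFree r (intInterval n) : ℝ) / 2 ^ n - r.choose 2, ?_, ?_⟩, ?_⟩
  · simpa using hall.sub_const (r.choose 2 : ℝ)
  · intro n
    field_simp
    ring
  · have h := htwo.div hall hC
    rw [div_self hC] at h
    refine h.congr fun n => ?_
    simp only [Pi.div_apply]
    rw [div_div_div_cancel_right₀ (by positivity)]
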